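/- Let $n\ge 0$ and let $X_1,\dots,X_n$ be independent random variables on a probability space, with values in measurable spaces $\mathfrak X_1,\dots,\mathfrak X_n$, respectively. Let $g:\mathfrak X_1\times\dots\times\mathfrak X_n\to\mathbb R$ be a measurable function that is separately Lipschitz with respect to measurable functions $\rho_i:\mathfrak X_i\times\mathfrak X_i\to\mathbb R$, that is, $$|g(x_1,\dots,x_{i-1},\tilde x_i,x_{i+1},\dots,x_n)-g(x_1,\dots,x_n)|\le\rho_i(\tilde x_i,x_i)$$ for all $i\in\{1,\dots,n\}$, all $(x_1,\dots,x_n)\in\mathfrak X_1\times\dots\times\mathfrak X_n$ and all $\tilde x_i\in\mathfrak X_i$. Let $Y:=g(X_1,\dots,X_n)$ and suppose that $Y$ has a finite mean. Let $p\in[2,\infty)$, and suppose that real constants $c_1(p)>0$ and $c_2(p)\ge0$ are such that for all real-valued martingales $(\zeta_j)_{j=0}^n$ with $\zeta_0=0$ and differences $\xi_i:=\zeta_i-\zeta_{i-1}$ $$\mathsf E|\zeta_n|^p\le c_1(p)\sum_{i=1}^n\mathsf E|\xi_i|^p+c_2(p)\Big(\sum_{i=1}^n\|\mathsf E_{i-1}\xi_i^2\|_\infty\Big)^{p/2},$$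 where $\mathsf E_j$ denotes the conditional expectation given $\zeta_0,\dots,\zeta_j$. Then for any points $x_i,y_i\in\mathfrak X_i$ ($i=1,\dots,n$) $$\mathsf E|Y-\mathsf E Y|^p\le C_p\,c_1(p)\sum_{i=1}^n\mathsf E\rho_i(X_i,x_i)^p+c_2(p)\Big(\sum_{i=1}^n\mathsf E\rho_i(X_i,y_i)^2\Big)^{p/2},$$ where $$C_p:=\sup\Big\{\frac{a\,b^p+b\,a^p}{a\,|b-t|^p+b\,|a+t|^p}\colon a>0,\ b>0,\ t\in\mathbb R\Big\}.$$ All expectations of nonnegative quantities are taken in $[0,\infty]$, with $0\cdot\infty=0$. -/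

import Mathlib

open MeasureTheory ProbabilityTheory
open scoped ENNReal

universe u v

/-- The best re-centering constant of a moment function `f`, with values in `[0, ∞]`: the supremum
over `a, b > 0` and real `t` of
`(a f(b) + b f(-a)) / (a f(b - t) + b f(-a - t))`. -/
noncomputable def centringConst (f : ℝ → ℝ) : ℝ≥0∞ :=
  ⨆ (a : ℝ) (_ : 0 < a) (b : ℝ) (_ : 0 < b) (t : ℝ),
    ENNReal.ofReal ((a * f b + b * f (-a)) / (a * f (b - t) + b * f (-a - t)))

/-- The constant `C_p`, i.e. the re-centering constant of the power function `|·| ^ p`. -/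
noncomputable def momentConst (p : ℝ) : ℝ≥0∞ :=
  centringConst fun x => |x| ^ p

/-- `g` is separately Lipschitz with respect to the functions `ρ i`: replacing the `i`-th coordinate
`x i` by `x'` changes the value of `g` by at most `ρ i x' (x i)`. -/
def SeparatelyLipschitz {n : ℕ} {S : Fin n → Type v} (g : (∀ i, S i) → ℝ)
    (ρ : ∀ i, S i → S i → ℝ) : Prop :=
  ∀ (i : Fin n) (x : ∀ i, S i) (x' : S i), |g (Function.update x i x') - g x| ≤ ρ i x' (x i)

/-- The Rosenthal-type inequality with exponent `p` and constants `c₁`, `c₂` for all real-valued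
martingales `ζ_0, …, ζ_n` (on arbitrary probability spaces) with `ζ_0 = 0`. The differences are
`ξ_i = ζ_i - ζ_{i-1}`, the conditional expectation `E_{i-1}` is given `ζ_0, …, ζ_{i-1}`, and all
moments are read in `[0, ∞]`. -/
def MartingaleRosenthal (n : ℕ) (p c₁ c₂ : ℝ) : Prop :=
  ∀ (Ω : Type u) [MeasurableSpace Ω] (P : Measure Ω) [IsProbabilityMeasure P]
    (ζ : Fin (n + 1) → Ω → ℝ) (hζ : ∀ j, StronglyMeasurable (ζ j)),
    Martingale ζ (Filtration.natural ζ hζ) P → ζ 0 = 0 →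
    ∫⁻ ω, ENNReal.ofReal (|ζ (Fin.last n) ω| ^ p) ∂P ≤
      ENNReal.ofReal c₁ *
          ∑ i : Fin n, ∫⁻ ω, ENNReal.ofReal (|ζ i.succ ω - ζ i.castSucc ω| ^ p) ∂P +
        ENNReal.ofReal c₂ *
          (∑ i : Fin n, essSup
            (P⁻[fun ω => ENNReal.ofReal ((ζ i.succ ω - ζ i.castSucc ω) ^ 2) |
              Filtration.natural ζ hζ i.castSucc]) P) ^ (p / 2)

/-!
With `F_j` the σ-algebra generated by the `X k`, `k < j`, the Doob martingale
`ζ_j = E[Y | F_j] - E Y` starts at `0` and ends at `Y - E Y`. It is a martingale for its own natural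
filtration, so the assumed Rosenthal-type inequality applies to it (`martingale_centredDoob`), and
it remains to bound the moments of its increments `ξ_i = E[Y | F_{i+1}] - E[Y | F_i]`.

Freeze the `i`-th argument of `g` at a point `z` and call the resulting variable `Z`. As `Z` is
independent of `X i`, its conditional expectations given `F_i` and `F_{i+1}` agree
(`condExp_sup_eq_of_indep`). So `ξ_i` is `η_i = E[Y - Z | F_{i+1}]` re-centered at its conditional
mean given `F_i`, while `|η_i| ≤ ρ_i(X_i, z)` by the Lipschitz condition.

Re-centering at the mean costs at most the factor `C_p` in the `p`-th moment. This holds for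
zero-mean two-point laws by the definition of `C_p`, hence for all zero-mean laws, which are
mixtures of such (`lintegral_abs_rpow_le_momentConst_mul`), and then conditionally, through the
conditional distribution (`lintegral_mul_abs_rpow_le_of_condExp_eq_zero`). With `z = x_i` this
bounds `E|ξ_i|^p`. With `z = y_i`, exponent `2` and `C_2 ≤ 1` it bounds the conditional second
moments, because `ρ_i(X_i, y_i)` is independent of `F_i` (`essSup_condLExp_condExp_sub_sq_le`).
-/

/-! ### The re-centering constant -/

/-- The defining inequality of `momentConst p` without division. The denominator never vanishes,
as `t` cannot equal both `b > 0` and `-a < 0`. -/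
theorem momentConst_two_point {p : ℝ} {a b : ℝ} (ha : 0 < a) (hb : 0 < b) (t : ℝ) :
    ENNReal.ofReal (a * |b| ^ p + b * |-a| ^ p) ≤
      momentConst p * ENNReal.ofReal (a * |b - t| ^ p + b * |-a - t| ^ p) := by
  have hden : 0 < a * |b - t| ^ p + b * |-a - t| ^ p := by
    rcases eq_or_ne b t with rfl | h
    · have h1 : 0 < |-a - b| := abs_pos.2 (by linarith)
      have := Real.rpow_pos_of_pos h1 p
      have := Real.rpow_nonneg (abs_nonneg (b - b)) p
      positivity
    · have h1 : 0 < |b - t| := abs_pos.2 (sub_ne_zero.2 h)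
      have := Real.rpow_pos_of_pos h1 p
      have := Real.rpow_nonneg (abs_nonneg (-a - t)) p
      positivity
  have hle : ENNReal.ofReal ((a * |b| ^ p + b * |-a| ^ p) /
      (a * |b - t| ^ p + b * |-a - t| ^ p)) ≤ momentConst p := by
    unfold momentConst centringConst
    exact le_iSup_of_le a <| le_iSup_of_le ha <| le_iSup_of_le b <| le_iSup_of_le hb <|
      le_iSup_of_le t le_rfl
  calc ENNReal.ofReal (a * |b| ^ p + b * |-a| ^ p)
      = ENNReal.ofReal ((a * |b| ^ p + b * |-a| ^ p) / (a * |b - t| ^ p + b * |-a - t| ^ p)) *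
          ENNReal.ofReal (a * |b - t| ^ p + b * |-a - t| ^ p) := by
        rw [← ENNReal.ofReal_mul' hden.le, div_mul_cancel₀ _ hden.ne']
    _ ≤ _ := by gcongr

theorem one_le_momentConst (p : ℝ) : 1 ≤ momentConst p := by
  have := momentConst_two_point (p := p) one_pos one_pos 0
  norm_num at this
  have h2 : (2 : ℝ≥0∞) * 1 ≤ 2 * momentConst p := by simpa [mul_comm] using this
  exact (ENNReal.mul_le_mul_iff_right (by simp) (by simp)).1 h2

/-- For `p = 2` the mean is the best re-centering: the second moment of a zero-mean variable
cannot be decreased by a shift. -/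
theorem momentConst_two_le_one : momentConst 2 ≤ 1 := by
  unfold momentConst centringConst
  refine iSup_le fun a => iSup_le fun ha => iSup_le fun b => iSup_le fun hb => iSup_le fun t => ?_
  rw [← ENNReal.ofReal_one]
  refine ENNReal.ofReal_le_ofReal ?_
  simp only [Real.rpow_two, sq_abs]
  apply div_le_one_of_le₀
  · nlinarith [mul_nonneg (add_pos ha hb).le (sq_nonneg t)]
  · positivity

/-- Every zero-mean law is a mixture of zero-mean two-point laws: with `m = E X⁺ = E X⁻`, the
integral `∬ (|v| f(u) + u f(v)) ν(du) ν(dv)` over `v < 0 < u` equals `m` times the integral of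
`f` off the origin. Hence the two-point inequality defining `momentConst p` passes to `ν`. -/
theorem lintegral_abs_rpow_le_momentConst_mul (ν : Measure ℝ) [IsFiniteMeasure ν] {p : ℝ}
    (hp : 0 < p) (hint : Integrable (fun y : ℝ => y) ν) (hmean : ∫ y, y ∂ν = 0) (t : ℝ) :
    ∫⁻ y, ENNReal.ofReal (|y| ^ p) ∂ν ≤
      momentConst p * ∫⁻ y, ENNReal.ofReal (|y - t| ^ p) ∂ν := by
  set m : ℝ≥0∞ := ∫⁻ y, ENNReal.ofReal y ∂ν with hm
  have hneg : ∫⁻ y, ENNReal.ofReal (-y) ∂ν = m := by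
    have h := integral_eq_lintegral_pos_part_sub_lintegral_neg_part hint
    rw [hmean, eq_comm, sub_eq_zero] at h
    rw [hm]
    exact ((ENNReal.toReal_eq_toReal_iff' hint.lintegral_lt_top.ne
      hint.neg.lintegral_lt_top.ne).1 h).symm
  have hmtop : m ≠ ∞ := hint.lintegral_lt_top.ne
  rcases eq_or_ne m 0 with hm0 | hm0
  · have h1 : ∀ᵐ y ∂ν, ENNReal.ofReal y = 0 :=
      (lintegral_eq_zero_iff ENNReal.measurable_ofReal).1 hm0
    have h2 : ∀ᵐ y ∂ν, ENNReal.ofReal (-y) = 0 :=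
      (lintegral_eq_zero_iff (by fun_prop)).1 (hneg.trans hm0)
    have h3 : ∫⁻ y, ENNReal.ofReal (|y| ^ p) ∂ν = 0 := by
      rw [lintegral_eq_zero_iff (by fun_prop)]
      filter_upwards [h1, h2] with y hy1 hy2
      have : y = 0 := le_antisymm (ENNReal.ofReal_eq_zero.1 hy1)
        (by linarith [ENNReal.ofReal_eq_zero.1 hy2])
      simp [this, Real.zero_rpow hp.ne']
    rw [h3]
    exact zero_le
  have hmP : ∫⁻ u in Set.Ioi 0, ENNReal.ofReal u ∂ν = m := by
    rw [hm, ← lintegral_indicator measurableSet_Ioi]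
    refine lintegral_congr fun y => ?_
    by_cases hy : 0 < y
    · simp [hy]
    · simp [hy, ENNReal.ofReal_of_nonpos (not_lt.1 hy)]
  have hmN : ∫⁻ v in Set.Iio 0, ENNReal.ofReal (-v) ∂ν = m := by
    rw [← hneg, ← lintegral_indicator measurableSet_Iio]
    refine lintegral_congr fun y => ?_
    by_cases hy : y < 0
    · simp [hy]
    · simp only [Set.mem_Iio, hy, not_false_eq_true, Set.indicator_of_notMem]
      rw [ENNReal.ofReal_of_nonpos (by linarith)]
  -- The mixture identity, with the shifted power as integrand.
  have key : ∀ s : ℝ, ∫⁻ u in Set.Ioi 0, ∫⁻ v in Set.Iio 0,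
      ENNReal.ofReal (-v * |u - s| ^ p + u * |v - s| ^ p) ∂ν ∂ν =
      m * (∫⁻ y in Set.Ioi 0, ENNReal.ofReal (|y - s| ^ p) ∂ν +
        ∫⁻ y in Set.Iio 0, ENNReal.ofReal (|y - s| ^ p) ∂ν) := by
    intro s
    have hin : ∀ u ∈ Set.Ioi (0 : ℝ), ∫⁻ v in Set.Iio 0,
        ENNReal.ofReal (-v * |u - s| ^ p + u * |v - s| ^ p) ∂ν =
        m * ENNReal.ofReal (|u - s| ^ p) +
          ENNReal.ofReal u * ∫⁻ y in Set.Iio 0, ENNReal.ofReal (|y - s| ^ p) ∂ν := by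
      intro u hu
      have hu : 0 < u := hu
      rw [← lintegral_const_mul _ (by fun_prop), ← hmN, ← lintegral_mul_const _ (by fun_prop),
        ← lintegral_add_left (by fun_prop)]
      refine setLIntegral_congr_fun measurableSet_Iio fun v hv => ?_
      have hv : v < 0 := hv
      have h1 := Real.rpow_nonneg (abs_nonneg (u - s)) p
      have h2 := Real.rpow_nonneg (abs_nonneg (v - s)) p
      rw [ENNReal.ofReal_add (mul_nonneg (by linarith) h1) (by positivity),
        ENNReal.ofReal_mul (by linarith), ENNReal.ofReal_mul hu.le]
    rw [setLIntegral_congr_fun measurableSet_Ioi hin, lintegral_add_left (by fun_prop),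
      lintegral_const_mul _ (by fun_prop), lintegral_mul_const _ (by fun_prop), hmP, mul_add]
  have hle : m * (∫⁻ y in Set.Ioi 0, ENNReal.ofReal (|y| ^ p) ∂ν +
        ∫⁻ y in Set.Iio 0, ENNReal.ofReal (|y| ^ p) ∂ν) ≤
      m * (momentConst p * (∫⁻ y in Set.Ioi 0, ENNReal.ofReal (|y - t| ^ p) ∂ν +
        ∫⁻ y in Set.Iio 0, ENNReal.ofReal (|y - t| ^ p) ∂ν)) := by
    have h0 := key 0
    simp only [sub_zero] at h0
    rw [mul_left_comm, ← key t, ← h0, ← lintegral_const_mul]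
    · refine setLIntegral_mono' measurableSet_Ioi fun u hu => ?_
      rw [← lintegral_const_mul _ (by fun_prop)]
      refine setLIntegral_mono' measurableSet_Iio fun v hv => ?_
      have := momentConst_two_point (p := p) (neg_pos.2 hv) hu t
      rwa [neg_neg] at this
    · have hF : Measurable fun z : ℝ × ℝ =>
          ENNReal.ofReal (-z.2 * |z.1 - t| ^ p + z.1 * |z.2 - t| ^ p) := by fun_prop
      exact hF.lintegral_prod_right'
  have hle' := (ENNReal.mul_le_mul_iff_right hm0 hmtop).1 hle
  have hdisj : Disjoint (Set.Ioi (0 : ℝ)) (Set.Iio 0) :=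
    Set.disjoint_left.2 fun y (hy : 0 < y) (hy' : y < 0) => lt_asymm hy hy'
  have hsplit : ∫⁻ y, ENNReal.ofReal (|y| ^ p) ∂ν =
      ∫⁻ y in Set.Ioi 0, ENNReal.ofReal (|y| ^ p) ∂ν +
        ∫⁻ y in Set.Iio 0, ENNReal.ofReal (|y| ^ p) ∂ν := by
    rw [← lintegral_union measurableSet_Iio hdisj]
    rw [← lintegral_indicator (measurableSet_Ioi.union measurableSet_Iio)]
    refine lintegral_congr fun y => ?_
    rcases eq_or_ne y 0 with rfl | hy
    · simp [Real.zero_rpow hp.ne']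
    · rw [Set.indicator_of_mem]
      exact hy.lt_or_gt.symm
  rw [hsplit]
  refine hle'.trans ?_
  gcongr
  rw [← lintegral_union measurableSet_Iio hdisj]
  exact setLIntegral_le_lintegral _ _

/-- Conditional form: given `X`, a zero-mean variable `ξ` is shifted by a function of `X`.
The inequality for zero-mean laws is applied to the conditional distribution of `ξ`. -/
theorem lintegral_mul_abs_rpow_le_of_condExp_eq_zero {Ω β : Type*} [MeasurableSpace Ω]
    {mβ : MeasurableSpace β} {P : Measure Ω} [IsFiniteMeasure P] {X : Ω → β} (hX : Measurable X)
    {ξ : Ω → ℝ} (hξ : Integrable ξ P) (hξ0 : P[ξ | mβ.comap X] =ᵐ[P] 0)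
    {τ : β → ℝ} (hτ : Measurable τ) {φ : β → ℝ≥0∞} (hφ : Measurable φ) {p : ℝ} (hp : 0 < p) :
    ∫⁻ ω, φ (X ω) * ENNReal.ofReal (|ξ ω| ^ p) ∂P ≤
      momentConst p * ∫⁻ ω, φ (X ω) * ENNReal.ofReal (|ξ ω + τ (X ω)| ^ p) ∂P := by
  -- `ξ` is integrated out first, given `X`.
  set κ := condDistrib ξ X P
  have disint : ∀ σ : β → ℝ, Measurable σ →
      ∫⁻ ω, φ (X ω) * ENNReal.ofReal (|ξ ω + σ (X ω)| ^ p) ∂P =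
      ∫⁻ ω, φ (X ω) * ∫⁻ y, ENNReal.ofReal (|y + σ (X ω)| ^ p) ∂κ (X ω) ∂P := by
    intro σ hσ
    have hF : Measurable fun z : β × ℝ => φ z.1 * ENNReal.ofReal (|z.2 + σ z.1| ^ p) := by
      fun_prop
    have h1 : ∫⁻ z, φ z.1 * ENNReal.ofReal (|z.2 + σ z.1| ^ p) ∂(P.map fun ω => (X ω, ξ ω)) =
        ∫⁻ ω, φ (X ω) * ENNReal.ofReal (|ξ ω + σ (X ω)| ^ p) ∂P :=
      lintegral_map' hF.aemeasurable (hX.aemeasurable.prodMk hξ.aemeasurable)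
    rw [← h1, ← compProd_map_condDistrib hξ.aemeasurable, Measure.lintegral_compProd hF,
      lintegral_map hF.lintegral_kernel_prod_right' hX]
    refine lintegral_congr fun ω => ?_
    exact lintegral_const_mul (μ := κ (X ω)) (φ (X ω))
      (by fun_prop : Measurable fun y : ℝ => ENNReal.ofReal (|y + σ (X ω)| ^ p))
  have h0 := disint (fun _ => 0) measurable_const
  simp only [add_zero] at h0
  rw [h0, disint τ hτ]
  have hmeas : Measurable fun ω => φ (X ω) * ∫⁻ y, ENNReal.ofReal (|y + τ (X ω)| ^ p) ∂κ (X ω) := by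
    have hF : Measurable fun z : β × ℝ => ENNReal.ofReal (|z.2 + τ z.1| ^ p) := by fun_prop
    exact (hφ.comp hX).mul ((hF.lintegral_kernel_prod_right' (κ := κ)).comp hX)
  rw [← lintegral_const_mul _ hmeas]
  have hmean := condExp_ae_eq_integral_condDistrib' hX hξ
  have hint : ∀ᵐ ω ∂P, Integrable (fun y : ℝ => y) (κ (X ω)) := by
    have hsnd : Integrable (fun z : β × ℝ => z.2) (P.map fun ω => (X ω, ξ ω)) :=
      (integrable_map_measure measurable_snd.aestronglyMeasurable
        (hX.aemeasurable.prodMk hξ.aemeasurable)).2 hξ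
    exact hsnd.condDistrib_ae hX.aemeasurable hξ.aemeasurable
  refine lintegral_mono_ae ?_
  filter_upwards [hmean, hξ0, hint] with ω h1 h2 h3
  rw [mul_left_comm]
  gcongr
  have := lintegral_abs_rpow_le_momentConst_mul (κ (X ω)) hp h3 (by rw [← h1, h2]; rfl) (-τ (X ω))
  simpa only [sub_neg_eq_add] using this

/-! ### Conditional expectations and independence -/

/-- Enlarging the conditioning by an independent σ-algebra does not change the conditional
expectation. -/
theorem condExp_sup_eq_of_indep {Ω : Type*} {m₁ m₂ H m₀ : MeasurableSpace Ω} {P : Measure Ω}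
    [IsProbabilityMeasure P] (h₁ : m₁ ≤ H) (hH : H ≤ m₀) (h₂ : m₂ ≤ m₀) (hind : Indep m₂ H P)
    {Z : Ω → ℝ} (hZ : StronglyMeasurable[H] Z) (hZint : Integrable Z P) :
    P[Z | m₁ ⊔ m₂] =ᵐ[P] P[Z | m₁] := by
  have h10 := h₁.trans hH
  have hsup : m₁ ⊔ m₂ ≤ m₀ := sup_le h10 h₂
  -- On a product set `s ∩ t` the independent factor `P t` splits off, for `Z` as for `P[Z | m₁]`;
  -- such sets form a π-system generating `m₁ ⊔ m₂`.
  have hfac : ∀ {f : Ω → ℝ}, StronglyMeasurable[H] f → ∀ {s t : Set Ω},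
      MeasurableSet[m₁] s → MeasurableSet[m₂] t →
      ∫ ω in s ∩ t, f ω ∂P = P.real t * ∫ ω in s, f ω ∂P := by
    intro f hf s t hs ht
    have hsf : StronglyMeasurable[H] (s.indicator f) := hf.indicator (h₁ _ hs)
    have h := Indep.setIntegral_eq_mul (m := m₂) (m𝓧 := H) (X := id) (P := P) (f := s.indicator f)
      h₂ (by rwa [MeasurableSpace.comap_id])
      (@Measurable.aemeasurable _ _ m₀ H id P (measurable_id'' hH)) ht
      (@StronglyMeasurable.aestronglyMeasurable _ _ _ H H _ _ hsf)
    simp only [id] at h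
    rwa [integral_indicator (h10 _ hs), integral_indicator (h10 _ hs),
      Measure.restrict_restrict (h10 _ hs)] at h
  have hsm : StronglyMeasurable[m₁ ⊔ m₂] (P[Z | m₁]) := stronglyMeasurable_condExp.mono le_sup_left
  refine (ae_eq_condExp_of_forall_setIntegral_eq hsup hZint
    (fun _ _ _ => integrable_condExp.integrableOn) ?_ hsm.aestronglyMeasurable).symm
  have hgen : m₁ ⊔ m₂ = MeasurableSpace.generateFrom
      {A | ∃ s t, MeasurableSet[m₁] s ∧ MeasurableSet[m₂] t ∧ A = s ∩ t} := by
    refine le_antisymm (sup_le (fun s hs => ?_) fun t ht => ?_)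
      (MeasurableSpace.generateFrom_le ?_)
    · exact MeasurableSpace.measurableSet_generateFrom
        ⟨s, Set.univ, hs, @MeasurableSet.univ _ m₂, (Set.inter_univ s).symm⟩
    · exact MeasurableSpace.measurableSet_generateFrom
        ⟨Set.univ, t, @MeasurableSet.univ _ m₁, ht, (Set.univ_inter t).symm⟩
    · rintro _ ⟨s, t, hs, ht, rfl⟩
      exact @MeasurableSet.inter _ (m₁ ⊔ m₂) _ _ (le_sup_left (b := m₂) s hs)
        (le_sup_right (a := m₁) t ht)
  have hpi : IsPiSystem {A | ∃ s t, MeasurableSet[m₁] s ∧ MeasurableSet[m₂] t ∧ A = s ∩ t} := by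
    rintro _ ⟨s, t, hs, ht, rfl⟩ _ ⟨s', t', hs', ht', rfl⟩ _
    exact ⟨s ∩ s', t ∩ t', @MeasurableSet.inter _ m₁ _ _ hs hs', @MeasurableSet.inter _ m₂ _ _ ht ht',
      Set.inter_inter_inter_comm s t s' t'⟩
  have hcint : Integrable (P[Z | m₁]) P := integrable_condExp
  suffices h : ∀ A, MeasurableSet[m₁ ⊔ m₂] A → ∫ ω in A, P[Z | m₁] ω ∂P = ∫ ω in A, Z ω ∂P from
    fun A hA _ => h A hA
  refine MeasurableSpace.induction_on_inter hgen hpi (by simp) ?_ ?_ ?_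
  · rintro _ ⟨s, t, hs, ht, rfl⟩
    rw [hfac (stronglyMeasurable_condExp.mono h₁) hs ht, hfac hZ hs ht,
      setIntegral_condExp h10 hZint hs]
  · intro A hA h
    rw [setIntegral_compl (hsup _ hA) hcint, setIntegral_compl (hsup _ hA) hZint, h,
      integral_condExp h10]
  · intro f hf hfm h
    rw [integral_iUnion (fun i => hsup _ (hfm i)) hf hcint.integrableOn,
      integral_iUnion (fun i => hsup _ (hfm i)) hf hZint.integrableOn]
    simp_rw [h]

/-- A bound on all set integrals bounds the conditional expectation in `L^∞`. -/
theorem essSup_condLExp_le {Ω : Type*} {G m₀ : MeasurableSpace Ω} {P : Measure Ω}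
    [IsProbabilityMeasure P] (hG : G ≤ m₀) {f : Ω → ℝ≥0∞} {c : ℝ≥0∞}
    (h : ∀ A, MeasurableSet[G] A → ∫⁻ ω in A, f ω ∂P ≤ c * P A) :
    essSup (P⁻[f | G]) P ≤ c := by
  have hae : P⁻[f | G] ≤ᵐ[P.trim hG] fun _ => c := by
    refine ae_le_of_forall_setLIntegral_le_of_sigmaFinite (measurable_condLExp G P f)
      fun A hA _ => ?_
    rw [setLIntegral_condLExp_trim hG P f hA, lintegral_const, Measure.restrict_apply_univ,
      trim_measurableSet_eq hG hA]
    exact h A hA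
  exact essSup_le_of_ae_le c (ae_of_ae_trim hG hae)

/-! ### Moments of an increment -/

theorem integrable_of_lintegral_rpow_ne_top {Ω : Type*} {m₀ : MeasurableSpace Ω} {P : Measure Ω}
    [IsFiniteMeasure P] {R : Ω → ℝ} (hR : AEStronglyMeasurable R P) (hR0 : ∀ ω, 0 ≤ R ω) {p : ℝ}
    (hp : 1 ≤ p) (h : ∫⁻ ω, ENNReal.ofReal (R ω ^ p) ∂P ≠ ∞) : Integrable R P := by
  have hint : Integrable (fun ω => R ω ^ p) P := by
    refine ⟨(hR.aemeasurable.pow_const p).aestronglyMeasurable, ?_⟩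
    rw [hasFiniteIntegral_iff_ofReal (ae_of_all _ fun ω => Real.rpow_nonneg (hR0 ω) p)]
    exact h.lt_top
  refine ((integrable_const (1 : ℝ)).add hint).mono' hR (ae_of_all _ fun ω => ?_)
  rw [Real.norm_of_nonneg (hR0 ω)]
  have hpos := Real.rpow_nonneg (hR0 ω) p
  simp only [Pi.add_apply]
  rcases le_total (R ω) 1 with h1 | h1
  · linarith
  · linarith [Real.self_le_rpow_of_one_le h1 hp]

/-- The increment `ξ = E[Y | m₁ ⊔ m₂] - E[Y | m₁]` differs from `η = E[Y - Z | m₁ ⊔ m₂]` by an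
`m₁`-measurable function, because `Z` does not depend on `m₂`; moreover `|η| ≤ R`. Since `ξ` has
zero conditional mean given `m₁`, it is a re-centering of `η`. -/
theorem setLIntegral_abs_condExp_sub_rpow_le {Ω : Type*} {m₁ m₂ H m₀ : MeasurableSpace Ω}
    {P : Measure Ω} [IsProbabilityMeasure P] (h₁ : m₁ ≤ H) (hH : H ≤ m₀) (h₂ : m₂ ≤ m₀)
    (hind : Indep m₂ H P) {Y Z R : Ω → ℝ} (hY : Integrable Y P) (hZ : StronglyMeasurable[H] Z)
    (hR : StronglyMeasurable[m₂] R) (hRint : Integrable R P) (hYZ : ∀ ω, |Y ω - Z ω| ≤ R ω)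
    {p : ℝ} (hp : 0 < p) {A : Set Ω} (hA : MeasurableSet[m₁] A) :
    ∫⁻ ω in A, ENNReal.ofReal (|(P[Y | m₁ ⊔ m₂]) ω - (P[Y | m₁]) ω| ^ p) ∂P ≤
      momentConst p * ∫⁻ ω in A, ENNReal.ofReal (R ω ^ p) ∂P := by
  have h10 := h₁.trans hH
  have hsup : m₁ ⊔ m₂ ≤ m₀ := sup_le h10 h₂
  have hD : Integrable (Y - Z) P :=
    hRint.mono' (hY.1.sub (hZ.mono hH).aestronglyMeasurable) (ae_of_all _ hYZ)
  have hZint : Integrable Z P := by simpa using hY.sub hD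
  have hR' : StronglyMeasurable[m₁ ⊔ m₂] R := hR.mono le_sup_right
  set ξ : Ω → ℝ := P[Y | m₁ ⊔ m₂] - P[Y | m₁] with hξdef
  set τ : Ω → ℝ := P[Y | m₁] - P[Z | m₁] with hτdef
  have hξ : Integrable ξ P := integrable_condExp.sub integrable_condExp
  have hτ : Measurable[m₁] τ :=
    (stronglyMeasurable_condExp.sub stronglyMeasurable_condExp).measurable
  have hξ0 : P[ξ | m₁] =ᵐ[P] 0 := by
    have hsub := condExp_sub (μ := P) (integrable_condExp (μ := P) (f := Y) (m := m₁ ⊔ m₂))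
      (integrable_condExp (μ := P) (f := Y) (m := m₁)) m₁
    have h2 := condExp_condExp_of_le (μ := P) (f := Y) (le_sup_left : m₁ ≤ m₁ ⊔ m₂) hsup
    have h3 := condExp_condExp_of_le (μ := P) (f := Y) (le_refl m₁) h10
    filter_upwards [hsub, h2, h3] with ω e1 e2 e3
    rw [hξdef, e1, Pi.sub_apply, e2, e3, sub_self, Pi.zero_apply]
  have hbound : ∀ᵐ ω ∂P, |ξ ω + τ ω| ≤ R ω := by
    have e0 := condExp_sub hY hZint (m₁ ⊔ m₂)
    have e1 := condExp_sup_eq_of_indep h₁ hH h₂ hind hZ hZint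
    have hup : P[Y - Z | m₁ ⊔ m₂] ≤ᵐ[P] P[R | m₁ ⊔ m₂] :=
      condExp_mono hD hRint (ae_of_all _ fun ω => (abs_le.1 (hYZ ω)).2)
    have hlo : P[-R | m₁ ⊔ m₂] ≤ᵐ[P] P[Y - Z | m₁ ⊔ m₂] :=
      condExp_mono hRint.neg hD (ae_of_all _ fun ω => (abs_le.1 (hYZ ω)).1)
    rw [condExp_of_stronglyMeasurable hsup hR' hRint] at hup
    rw [condExp_of_stronglyMeasurable hsup hR'.neg hRint.neg] at hlo
    filter_upwards [e0, e1, hup, hlo] with ω e0 e1 hup hlo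
    have : ξ ω + τ ω = (P[Y - Z | m₁ ⊔ m₂]) ω := by
      rw [e0, Pi.sub_apply, e1]
      simp only [hξdef, hτdef, Pi.sub_apply]
      ring
    rw [this]
    exact abs_le.2 ⟨hlo, hup⟩
  have hφ : Measurable[m₁] (A.indicator (1 : Ω → ℝ≥0∞)) :=
    (StronglyMeasurable.indicator stronglyMeasurable_one hA).measurable
  have hmain := lintegral_mul_abs_rpow_le_of_condExp_eq_zero (mβ := m₁) (X := id) (P := P)
    (measurable_id'' h10) hξ (by rwa [MeasurableSpace.comap_id]) hτ
    hφ hp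
  have hweight : ∀ f : Ω → ℝ≥0∞, ∫⁻ ω, A.indicator 1 ω * f ω ∂P = ∫⁻ ω in A, f ω ∂P := by
    intro f
    rw [← lintegral_indicator (h10 _ hA)]
    refine lintegral_congr fun ω => ?_
    by_cases hω : ω ∈ A <;> simp [hω]
  simp only [id, hweight] at hmain
  refine hmain.trans ?_
  gcongr 1
  refine lintegral_mono_ae (ae_restrict_of_ae ?_)
  filter_upwards [hbound] with ω hω
  gcongr

/-- The conclusion of `setLIntegral_abs_condExp_sub_rpow_le` needs no integrability of `R`, since
its right-hand side is infinite for a non-integrable `R`. -/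
theorem lintegral_abs_condExp_sub_rpow_le {Ω : Type*} {m₁ m₂ H m₀ : MeasurableSpace Ω}
    {P : Measure Ω} [IsProbabilityMeasure P] (h₁ : m₁ ≤ H) (hH : H ≤ m₀) (h₂ : m₂ ≤ m₀)
    (hind : Indep m₂ H P) {Y Z R : Ω → ℝ} (hY : Integrable Y P) (hZ : StronglyMeasurable[H] Z)
    (hR : StronglyMeasurable[m₂] R) (hYZ : ∀ ω, |Y ω - Z ω| ≤ R ω) {p : ℝ} (hp : 1 ≤ p) :
    ∫⁻ ω, ENNReal.ofReal (|(P[Y | m₁ ⊔ m₂]) ω - (P[Y | m₁]) ω| ^ p) ∂P ≤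
      momentConst p * ∫⁻ ω, ENNReal.ofReal (R ω ^ p) ∂P := by
  rcases eq_or_ne (∫⁻ ω, ENNReal.ofReal (R ω ^ p) ∂P) ∞ with h | h
  · rw [h, ENNReal.mul_top (one_pos.trans_le (one_le_momentConst p)).ne']
    exact le_top
  · have hRint := integrable_of_lintegral_rpow_ne_top (hR.mono h₂).aestronglyMeasurable
      (fun ω => (abs_nonneg _).trans (hYZ ω)) hp h
    simpa using setLIntegral_abs_condExp_sub_rpow_le h₁ hH h₂ hind hY hZ hR hRint hYZ
      (one_pos.trans_le hp) (@MeasurableSet.univ _ m₁)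

/-- The conditional second moment of the increment, given any coarser σ-algebra `G`, is bounded by
the unconditional second moment of `R`: on `m₁`-sets re-centering does not increase second moments
(`momentConst_two_le_one`), and `R` is independent of `m₁`. -/
theorem essSup_condLExp_condExp_sub_sq_le {Ω : Type*} {G m₁ m₂ H m₀ : MeasurableSpace Ω}
    {P : Measure Ω} [IsProbabilityMeasure P] (hG : G ≤ m₁) (h₁ : m₁ ≤ H) (hH : H ≤ m₀)
    (h₂ : m₂ ≤ m₀) (hind : Indep m₂ H P) {Y Z R : Ω → ℝ} (hY : Integrable Y P)
    (hZ : StronglyMeasurable[H] Z) (hR : StronglyMeasurable[m₂] R)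
    (hYZ : ∀ ω, |Y ω - Z ω| ≤ R ω) :
    essSup (P⁻[fun ω => ENNReal.ofReal (((P[Y | m₁ ⊔ m₂]) ω - (P[Y | m₁]) ω) ^ 2) | G]) P ≤
      ∫⁻ ω, ENNReal.ofReal (R ω ^ 2) ∂P := by
  rcases eq_or_ne (∫⁻ ω, ENNReal.ofReal (R ω ^ 2) ∂P) ∞ with h | h
  · rw [h]
    exact le_top
  have h10 := h₁.trans hH
  have hRint := integrable_of_lintegral_rpow_ne_top (p := 2) (hR.mono h₂).aestronglyMeasurable
      (fun ω => (abs_nonneg _).trans (hYZ ω)) one_le_two (by simpa using h)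
  refine essSup_condLExp_le (hG.trans h10) fun A hA => ?_
  have hA₁ : MeasurableSet[m₁] A := hG _ hA
  have h2 := setLIntegral_abs_condExp_sub_rpow_le h₁ hH h₂ hind hY hZ hR hRint hYZ two_pos hA₁
  simp only [Real.rpow_two, sq_abs] at h2
  refine h2.trans ((mul_le_of_le_one_left' momentConst_two_le_one).trans (le_of_eq ?_))
  have hφ : Measurable[m₁] (A.indicator (1 : Ω → ℝ≥0∞)) :=
    (StronglyMeasurable.indicator stronglyMeasurable_one hA₁).measurable
  have hprod := lintegral_mul_eq_lintegral_mul_lintegral_of_independent_measurableSpace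
    h₂ h10 (indep_of_indep_of_le_right hind h₁) (f := fun ω => ENNReal.ofReal (R ω ^ 2))
    (hR.measurable.pow_const 2).ennreal_ofReal hφ
  rw [lintegral_indicator_one (h10 _ hA₁)] at hprod
  rw [← hprod, ← lintegral_indicator (h10 _ hA₁)]
  refine lintegral_congr fun ω => ?_
  by_cases hω : ω ∈ A <;> simp [hω]

/-! ### The martingale of successive conditional expectations -/

/-- The σ-algebra generated by the variables `X k` with `k < j`. The index `j` runs over
`Fin (n + 1)`, so that `j = 0` gives the trivial σ-algebra and the last `j` uses all variables. -/
abbrev pastSigma {n : ℕ} {Ω : Type u} {S : Fin n → Type v} [∀ i, MeasurableSpace (S i)]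
    (X : ∀ i, Ω → S i) (j : Fin (n + 1)) : MeasurableSpace Ω :=
  ⨆ k ∈ {k : Fin n | k.castSucc < j}, MeasurableSpace.comap (X k) inferInstance

section PastSigma

variable {n : ℕ} {Ω : Type u} {S : Fin n → Type v} [∀ i, MeasurableSpace (S i)]
  (X : ∀ i, Ω → S i)

theorem pastSigma_mono : Monotone (pastSigma X) := fun _ _ hij =>
  biSup_mono fun _ hk => lt_of_lt_of_le hk hij

theorem pastSigma_le {m₀ : MeasurableSpace Ω} (hX : ∀ i, Measurable (X i)) (j : Fin (n + 1)) :
    pastSigma X j ≤ m₀ :=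
  iSup₂_le fun k _ => (hX k).comap_le

theorem pastSigma_zero : pastSigma X 0 = ⊥ := by
  simp [pastSigma]

theorem pastSigma_succ (i : Fin n) :
    pastSigma X i.succ = pastSigma X i.castSucc ⊔ MeasurableSpace.comap (X i) inferInstance := by
  have hset : {k : Fin n | k.castSucc < i.succ} = {k : Fin n | k.castSucc < i.castSucc} ∪ {i} := by
    ext k
    simp only [Set.mem_ofPred_eq, Set.mem_union, Set.mem_singleton_iff, Fin.lt_def, Fin.ext_iff,
      Fin.val_castSucc, Fin.val_succ]
    omega
  rw [pastSigma, pastSigma, hset, iSup_union, iSup_singleton]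

theorem pastSigma_castSucc_le (i : Fin n) :
    pastSigma X i.castSucc ≤ ⨆ k ∈ ({i}ᶜ : Set (Fin n)), MeasurableSpace.comap (X k) inferInstance :=
  biSup_mono fun k (hk : k.castSucc < i.castSucc) => by
    rintro rfl
    exact lt_irrefl _ hk

theorem measurable_pi_pastSigma_last :
    Measurable[pastSigma X (Fin.last n)] fun ω i => X i ω := by
  refine @measurable_pi_lambda _ _ _ (pastSigma X (Fin.last n)) _ _ fun i => ?_
  exact Measurable.of_comap_le (le_iSup₂_of_le i (Fin.castSucc_lt_last i) le_rfl)

end PastSigma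

/-- The Doob martingale `E[Y | X_0, …, X_{j-1}] - E Y` of `Y`. -/
noncomputable def centredDoob {n : ℕ} {Ω : Type u} [MeasurableSpace Ω] (P : Measure Ω)
    {S : Fin n → Type v} [∀ i, MeasurableSpace (S i)] (X : ∀ i, Ω → S i) (Y : Ω → ℝ)
    (j : Fin (n + 1)) (ω : Ω) : ℝ :=
  (P[Y | pastSigma X j]) ω - ∫ ω', Y ω' ∂P

section CentredDoob

variable {n : ℕ} {Ω : Type u} [MeasurableSpace Ω] (P : Measure Ω) {S : Fin n → Type v}
  [∀ i, MeasurableSpace (S i)] (X : ∀ i, Ω → S i) (Y : Ω → ℝ)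

theorem stronglyMeasurable_centredDoob_pastSigma (j : Fin (n + 1)) :
    StronglyMeasurable[pastSigma X j] (centredDoob P X Y j) :=
  stronglyMeasurable_condExp.sub stronglyMeasurable_const

theorem stronglyMeasurable_centredDoob (hX : ∀ i, Measurable (X i)) (j : Fin (n + 1)) :
    StronglyMeasurable (centredDoob P X Y j) :=
  (stronglyMeasurable_centredDoob_pastSigma P X Y j).mono (pastSigma_le X hX j)

theorem natural_centredDoob_le (hX : ∀ i, Measurable (X i)) (j : Fin (n + 1)) :
    Filtration.natural (centredDoob P X Y) (stronglyMeasurable_centredDoob P X Y hX) j ≤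
      pastSigma X j :=
  iSup₂_le fun k hk => (((stronglyMeasurable_centredDoob_pastSigma P X Y k).mono
    (pastSigma_mono X hk)).measurable).comap_le

theorem centredDoob_zero [IsProbabilityMeasure P] : centredDoob P X Y 0 = 0 := by
  funext ω
  simp only [centredDoob, pastSigma_zero, condExp_bot, sub_self, Pi.zero_apply]

theorem centredDoob_succ_sub (i : Fin n) (ω : Ω) :
    centredDoob P X Y i.succ ω - centredDoob P X Y i.castSucc ω =
      (P[Y | pastSigma X i.castSucc ⊔ MeasurableSpace.comap (X i) inferInstance]) ω -
        (P[Y | pastSigma X i.castSucc]) ω := by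
  simp only [centredDoob, pastSigma_succ]
  ring

/-- The Doob martingale is also a martingale for its own, coarser, natural filtration. -/
theorem martingale_centredDoob [IsProbabilityMeasure P] (hX : ∀ i, Measurable (X i)) :
    Martingale (centredDoob P X Y)
      (Filtration.natural (centredDoob P X Y) (stronglyMeasurable_centredDoob P X Y hX)) P := by
  have hint : ∀ j, Integrable (centredDoob P X Y j) P := fun j =>
    integrable_condExp.sub (integrable_const _)
  set G := Filtration.natural (centredDoob P X Y) (stronglyMeasurable_centredDoob P X Y hX)
    with hG
  have hadap : StronglyAdapted G (centredDoob P X Y) := Filtration.stronglyAdapted_natural _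
  refine ⟨hadap, fun i j hij => ?_⟩
  have hstep : P[centredDoob P X Y j | pastSigma X i] =ᵐ[P] centredDoob P X Y i := by
    have h1 := condExp_sub (μ := P) (integrable_condExp (μ := P) (f := Y) (m := pastSigma X j))
      (integrable_const (∫ ω', Y ω' ∂P)) (pastSigma X i)
    have h2 := condExp_condExp_of_le (μ := P) (f := Y) (pastSigma_mono X hij) (pastSigma_le X hX j)
    have h3 := condExp_const (μ := P) (pastSigma_le X hX i) (∫ ω', Y ω' ∂P)
    change P[P[Y | pastSigma X j] - (fun _ => ∫ ω', Y ω' ∂P) | pastSigma X i] =ᵐ[P] _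
    filter_upwards [h1, h2] with ω e1 e2
    rw [e1, Pi.sub_apply, e2, h3, centredDoob]
  have htower := condExp_condExp_of_le (μ := P) (f := centredDoob P X Y j)
    (natural_centredDoob_le P X Y hX i) (pastSigma_le X hX i)
  refine htower.symm.trans ((condExp_congr_ae hstep).trans ?_)
  rw [condExp_of_stronglyMeasurable (G.le i) (hadap i) (hint i)]

end CentredDoob

/-! ### The moment inequality -/

theorem mainTheorem4 {n : ℕ} {Ω : Type u} [MeasurableSpace Ω] (P : Measure Ω)
    [IsProbabilityMeasure P]
    {S : Fin n → Type v} [∀ i, MeasurableSpace (S i)]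
    (X : ∀ i, Ω → S i) (hX : ∀ i, Measurable (X i)) (hindep : iIndepFun X P)
    (g : (∀ i, S i) → ℝ) (hg : Measurable g)
    (ρ : ∀ i, S i → S i → ℝ) (hρ : ∀ i, Measurable (fun z : S i × S i => ρ i z.1 z.2))
    (hLip : SeparatelyLipschitz g ρ)
    (Y : Ω → ℝ) (hY : Y = fun ω => g (fun i => X i ω)) (hYint : Integrable Y P)
    (p : ℝ) (hp : 2 ≤ p) (c₁ c₂ : ℝ) (hc₁ : 0 < c₁) (hc₂ : 0 ≤ c₂)
    (hmart : MartingaleRosenthal.{u} n p c₁ c₂)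
    (x y : ∀ i, S i) :
    ∫⁻ ω, ENNReal.ofReal (|Y ω - ∫ ω', Y ω' ∂P| ^ p) ∂P ≤
      momentConst p * ENNReal.ofReal c₁ *
          ∑ i : Fin n, ∫⁻ ω, ENNReal.ofReal (ρ i (X i ω) (x i) ^ p) ∂P +
        ENNReal.ofReal c₂ *
          (∑ i : Fin n, ∫⁻ ω, ENNReal.ofReal (ρ i (X i ω) (y i) ^ 2) ∂P) ^ (p / 2) := by
  have hlast : centredDoob P X Y (Fin.last n) = fun ω => Y ω - ∫ ω', Y ω' ∂P := by
    have hYm : StronglyMeasurable[pastSigma X (Fin.last n)] Y := by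
      rw [hY]
      exact (hg.comp (measurable_pi_pastSigma_last X)).stronglyMeasurable
    funext ω
    rw [centredDoob, condExp_of_stronglyMeasurable (pastSigma_le X hX _) hYm hYint]
  have hXle : ∀ i, MeasurableSpace.comap (X i) inferInstance ≤ ‹MeasurableSpace Ω› :=
    fun i => (hX i).comap_le
  have hothers : ∀ i : Fin n, (⨆ k ∈ ({i}ᶜ : Set (Fin n)),
      MeasurableSpace.comap (X k) inferInstance) ≤ ‹MeasurableSpace Ω› :=
    fun i => iSup₂_le fun k _ => hXle k
  have hind : ∀ i : Fin n, Indep (MeasurableSpace.comap (X i) inferInstance)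
      (⨆ k ∈ ({i}ᶜ : Set (Fin n)), MeasurableSpace.comap (X k) inferInstance) P := by
    intro i
    have h := indep_iSup_of_disjoint hXle hindep (S := {i}) (T := {i}ᶜ) disjoint_compl_right
    rwa [iSup_singleton] at h
  -- `Y` with its `i`-th argument frozen at `z`: a function of the other variables only.
  have hfrozen : ∀ (i : Fin n) (z : S i),
      StronglyMeasurable[⨆ k ∈ ({i}ᶜ : Set (Fin n)), MeasurableSpace.comap (X k) inferInstance]
        fun ω => g (Function.update (fun k => X k ω) i z) := by
    intro i z
    refine (hg.comp (@measurable_pi_lambda _ _ _ (⨆ k ∈ ({i}ᶜ : Set (Fin n)),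
      MeasurableSpace.comap (X k) inferInstance) _ _ fun k => ?_)).stronglyMeasurable
    rcases eq_or_ne k i with rfl | hk
    · simp only [Function.update_self]
      exact @measurable_const _ _ _ (_) _
    · simp only [Function.update_of_ne hk]
      exact Measurable.of_comap_le (le_iSup₂_of_le k hk le_rfl)
  have hdist : ∀ (i : Fin n) (z : S i) (ω : Ω),
      |Y ω - g (Function.update (fun k => X k ω) i z)| ≤ ρ i (X i ω) z := by
    intro i z ω
    -- Start from the frozen point and restore `X i ω`, so that `ρ` gets its arguments in this order.
    have h := hLip i (Function.update (fun k => X k ω) i z) (X i ω)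
    rwa [Function.update_idem, Function.update_self, Function.update_eq_self, ← congrFun hY ω] at h
  have hρX : ∀ (i : Fin n) (z : S i),
      StronglyMeasurable[MeasurableSpace.comap (X i) inferInstance] fun ω => ρ i (X i ω) z :=
    fun i z => (((hρ i).comp measurable_prodMk_right).comp
      (comap_measurable (X i))).stronglyMeasurable
  have hmoment : ∀ i : Fin n, ∫⁻ ω, ENNReal.ofReal
      (|centredDoob P X Y i.succ ω - centredDoob P X Y i.castSucc ω| ^ p) ∂P ≤
      momentConst p * ∫⁻ ω, ENNReal.ofReal (ρ i (X i ω) (x i) ^ p) ∂P := by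
    intro i
    simp only [centredDoob_succ_sub]
    exact lintegral_abs_condExp_sub_rpow_le (pastSigma_castSucc_le X i) (hothers i) (hXle i)
      (hind i) hYint (hfrozen i (x i)) (hρX i (x i)) (hdist i (x i)) (by linarith)
  have hcond : ∀ i : Fin n, essSup (P⁻[fun ω => ENNReal.ofReal
      ((centredDoob P X Y i.succ ω - centredDoob P X Y i.castSucc ω) ^ 2) |
        Filtration.natural (centredDoob P X Y) (stronglyMeasurable_centredDoob P X Y hX)
          i.castSucc]) P ≤ ∫⁻ ω, ENNReal.ofReal (ρ i (X i ω) (y i) ^ 2) ∂P := by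
    intro i
    simp only [centredDoob_succ_sub]
    exact essSup_condLExp_condExp_sub_sq_le (natural_centredDoob_le P X Y hX i.castSucc)
      (pastSigma_castSucc_le X i) (hothers i) (hXle i) (hind i) hYint (hfrozen i (y i))
      (hρX i (y i)) (hdist i (y i))
  have h := hmart Ω P (centredDoob P X Y) (stronglyMeasurable_centredDoob P X Y hX)
    (martingale_centredDoob P X Y hX) (centredDoob_zero P X Y)
  simp only [hlast] at h
  refine h.trans (add_le_add ?_ ?_)
  · rw [mul_comm (momentConst p), mul_assoc]
    refine mul_le_mul' le_rfl ((Finset.sum_le_sum fun i _ => hmoment i).trans ?_)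
    rw [Finset.mul_sum]
  · exact mul_le_mul' le_rfl
      (ENNReal.rpow_le_rpow (Finset.sum_le_sum fun i _ => hcond i) (by linarith))
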